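/- Let $n\ge 3$. The degree partition of a simple graph on $n$ vertices is the vector in $\mathbb{R}^n$ obtained by arranging its vertex degrees (including zeros) in weakly decreasing order. Let $\mathsf{DP}(n)\subseteq\mathbb{R}^n$ be the convex hull of the degree partitions of all simple graphs on $n$ vertices, and let $TP(n)$ be the set of degree partitions of threshold graphs on $n$ vertices, where a graph is threshold if every induced subgraph on a nonempty vertex set has a dominating vertex (adjacent to all the others) or an isolated vertex. An interval of $[n]=\{1,\dots,n\}$ is a nonempty set $\{i,i+1,\dots,j\}$ with $i\le j$; it is nontrivial if it has at least two elements. For a nontrivial interval $I$ let $\Omega_I\in\mathbb{R}^n$ be the vector with entries $\#I-1$ at the positions in $I$ and $0$ elsewhere. For two intervals $I,J$ with $\max I<\min J$ let $\Omega_{I,J}\in\mathbb{R}^n$ be the vector with entries $\#J$ at the positions in $I$, $\#I$ at the positions in $J$, and $0$ elsewhere. Let $d,e\in TP(n)$. Then $d$ and $e$ are adjacent extreme points of $\mathsf{DP}(n)$ (that is, they are distinct extreme points and the segment joining them is a face of $\mathsf{DP}(n)$) if and only if the following two conditions both hold: 1. $d$ and $e$ are comparable componentwise: $d_i\le e_i$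 for all $i$, or $e_i\le d_i$ for all $i$; 2. the vector $|d-e|=(|d_1-e_1|,\dots,|d_n-e_n|)$ equals $\Omega_I$ for some nontrivial interval $I$ of $[n]$, or equals $\Omega_{I,J}$ for some pair of intervals $I,J$ of $[n]$ with $\max I<\min J$. -/

import Mathlib

namespace DegreePartitions

open Classical in
/-- The degree sequence of a graph on `n` vertices, as a vector in `ℝⁿ`. -/
noncomputable def degreeSequence {n : ℕ} (G : SimpleGraph (Fin n)) : Fin n → ℝ :=
  fun v => (G.degree v : ℝ)

/-- `d` is the degree partition of `G`: its degree sequence, rearranged in weakly decreasing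
order (zero entries are kept). -/
def IsDegreePartition {n : ℕ} (G : SimpleGraph (Fin n)) (d : Fin n → ℝ) : Prop :=
  Antitone d ∧ ∃ σ : Equiv.Perm (Fin n), d = degreeSequence G ∘ σ

/-- `v` is adjacent to every other vertex. -/
def IsDominatingVertex {V : Type*} (G : SimpleGraph V) (v : V) : Prop :=
  ∀ w, w ≠ v → G.Adj v w

/-- `v` is adjacent to no vertex. -/
def IsIsolatedVertex {V : Type*} (G : SimpleGraph V) (v : V) : Prop :=
  ∀ w, ¬ G.Adj v w

/-- A graph is threshold if every induced subgraph (on a nonempty vertex set) has a dominating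
or an isolated vertex. -/
def IsThreshold {V : Type*} (G : SimpleGraph V) : Prop :=
  ∀ S : Set V, S.Nonempty →
    ∃ v : S, IsDominatingVertex (G.induce S) v ∨ IsIsolatedVertex (G.induce S) v

/-- The set `DP(n)` of degree partitions of simple graphs on `n` vertices. -/
def degreePartitions (n : ℕ) : Set (Fin n → ℝ) :=
  {d | ∃ G : SimpleGraph (Fin n), IsDegreePartition G d}

/-- The set `TP(n)` of threshold partitions: degree partitions of threshold graphs on `n`
vertices. -/
def thresholdPartitions (n : ℕ) : Set (Fin n → ℝ) :=
  {d | ∃ G : SimpleGraph (Fin n), IsThreshold G ∧ IsDegreePartition G d}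

/-- The polytope of degree partitions. -/
def degreePartitionPolytope (n : ℕ) : Set (Fin n → ℝ) :=
  convexHull ℝ (degreePartitions n)

/-- `x` and `y` are adjacent extreme points of `P`: distinct extreme points such that the segment
between them is a face of `P`, that is, the set of maximizers over `P` of a linear functional. -/
def AdjacentExtremePoints {n : ℕ} (P : Set (Fin n → ℝ)) (x y : Fin n → ℝ) : Prop :=
  x ∈ P.extremePoints ℝ ∧ y ∈ P.extremePoints ℝ ∧ x ≠ y ∧ IsExposed ℝ P (segment ℝ x y)

/-- A (nonempty) interval `{i, i+1, …, j}` of the index set. -/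
def IsInterval {n : ℕ} (I : Finset (Fin n)) : Prop :=
  ∃ i j : Fin n, i ≤ j ∧ I = Finset.Icc i j

/-- The vector `Ω_I`, equal to `#I - 1` on `I` and to `0` elsewhere. -/
def omega {n : ℕ} (I : Finset (Fin n)) : Fin n → ℝ :=
  fun i => if i ∈ I then (I.card : ℝ) - 1 else 0

/-- The vector `Ω_{I,J}`, equal to `#J` on `I`, to `#I` on `J` and to `0` elsewhere. -/
def omegaPair {n : ℕ} (I J : Finset (Fin n)) : Fin n → ℝ :=
  fun i => if i ∈ I then (J.card : ℝ) else if i ∈ J then (I.card : ℝ) else 0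

end DegreePartitions

/-!
A linear functional `w` on degree sequences splits as `∑ (w i + w j)` over the edges `ij`, so its
maximizers are the graphs that contain all pairs of positive weight, no pairs of negative weight and
arbitrary pairs of weight zero. Threshold partitions are exactly the degree sequences of the graphs
that are shifted with respect to the order of the vertices, and each of these is the only maximizer
for the weight `degree - index`.

Only weakly decreasing degree sequences span the polytope. By Moreau's decomposition a functional
can therefore be replaced by its projection `w` to the cone of weakly decreasing vectors. If it
exposes a segment with ends `E < F`, then `F \ E` consists of the pairs of `w`-weight zero, and all
of them lie in the levels `±s` of `w` for a single `s`, as otherwise there would be a third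
maximizer in between. For `s = 0` the pairs form a clique on an interval, which gives `Ω_I`; for
`s > 0` they form a complete bipartite graph between two intervals, which gives `Ω_{I,J}`.

Conversely, a weight with this property exposes a segment once a functional is added that penalizes
sequences that are not constant on the levels of `w`. If `F \ E` has degrees `Ω_I` or `Ω_{I,J}`,
such a weight is obtained by summing `degree - index` over `E` and `F` and symmetrizing it under the
reversal of the intervals.
-/

namespace DegreePartitions

open scoped RealInnerProductSpace

section Convexity

lemma isExposed_convexHull_sep {E : Type*} [AddCommGroup E] [Module ℝ E] [TopologicalSpace E]
    {S : Set E} {l : StrongDual ℝ E} {M : ℝ} (hM : ∀ s ∈ S, l s ≤ M) :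
    IsExposed ℝ (convexHull ℝ S) (convexHull ℝ {s ∈ S | l s = M}) := by
  set T := {s ∈ S | l s = M}
  have hle : ∀ x ∈ convexHull ℝ S, l x ≤ M :=
    convexHull_min hM (convex_halfSpace_le l.toLinearMap.isLinear M)
  have heq : ∀ x ∈ convexHull ℝ T, l x = M :=
    convexHull_min (fun s hs => hs.2) (convex_hyperplane l.toLinearMap.isLinear M)
  have hconv : Convex ℝ {x | l x ≤ M ∧ (l x = M → x ∈ convexHull ℝ T)} := by
    rw [convex_iff_forall_pos]
    rintro x ⟨hx, hxT⟩ y ⟨hy, hyT⟩ a b ha hb hab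
    have hax := mul_le_mul_of_nonneg_left hx ha.le
    have hby := mul_le_mul_of_nonneg_left hy hb.le
    have hsum : a * M + b * M = M := by rw [← add_mul, hab, one_mul]
    simp only [Set.mem_ofPred_eq, map_add, map_smul, smul_eq_mul]
    refine ⟨by linarith, fun h => convex_convexHull ℝ T (hxT ?_) (hyT ?_) ha.le hb.le hab⟩
    · exact mul_left_cancel₀ ha.ne' (by linarith)
    · exact mul_left_cancel₀ hb.ne' (by linarith)
  have hface : ∀ x ∈ convexHull ℝ S, l x = M → x ∈ convexHull ℝ T := fun x hx =>
    (convexHull_min (fun s hs => And.intro (hM s hs) fun h => subset_convexHull ℝ T ⟨hs, h⟩)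
      hconv hx).2
  rintro ⟨z, hz⟩
  refine ⟨l, Set.Subset.antisymm (fun x hx => ?_) ?_⟩
  · exact ⟨convexHull_mono (Set.sep_subset _ _) hx, fun y hy => (heq x hx).symm ▸ hle y hy⟩
  · rintro x ⟨hx, hmax⟩
    have hzx := hmax z (convexHull_mono (Set.sep_subset _ _) hz)
    exact hface x hx (le_antisymm (hle x hx) (heq z hz ▸ hzx))

lemma exists_moreau_decomposition {E : Type*} [NormedAddCommGroup E] [InnerProductSpace ℝ E]
    {K : PointedCone ℝ E} (hK : IsComplete (K : Set E)) (c : E) :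
    ∃ w ∈ K, ⟪c - w, w⟫ = 0 ∧ ∀ g ∈ K, ⟪c - w, g⟫ ≤ 0 := by
  have hconv : Convex ℝ (K : Set E) := PointedCone.convex K
  obtain ⟨w, hw, hmin⟩ := exists_norm_eq_iInf_of_complete_convex ⟨0, K.zero_mem⟩ hK hconv c
  rw [norm_eq_iInf_iff_real_inner_le_zero hconv hw] at hmin
  have hpolar : ∀ g ∈ K, ⟪c - w, g⟫ ≤ 0 := fun g hg => by
    simpa using hmin (g + w) (K.add_mem hg hw)
  refine ⟨w, hw, le_antisymm (hpolar w hw) ?_, hpolar⟩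
  simpa using hmin 0 K.zero_mem

end Convexity

section AntitoneVectors

variable {ι : Type*}

/-- The cone of weakly decreasing vectors, in the Euclidean space whose inner product is the dot
product. -/
def antitoneCone (ι : Type*) [Preorder ι] : PointedCone ℝ (EuclideanSpace ℝ ι) where
  carrier := {x | Antitone fun i => x i}
  zero_mem' := antitone_const
  add_mem' hx hy := hx.add hy
  smul_mem' r _ hx _ _ hij := mul_le_mul_of_nonneg_left (hx hij) r.2

lemma isClosed_antitoneCone [Preorder ι] :
    IsClosed (antitoneCone ι : Set (EuclideanSpace ℝ ι)) := by
  have hset : (antitoneCone ι : Set (EuclideanSpace ℝ ι)) =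
      ⋂ (i) (j) (_ : i ≤ j), {x | x j ≤ x i} := by
    ext x
    simp only [Set.mem_iInter]
    rfl
  rw [hset]
  exact isClosed_iInter fun i => isClosed_iInter fun j => isClosed_iInter fun _ =>
    isClosed_le (by fun_prop) (by fun_prop)

variable [Fintype ι]

lemma exists_antitone_add_polar [Preorder ι] (c : ι → ℝ) :
    ∃ w p : ι → ℝ, c = w + p ∧ Antitone w ∧ p ⬝ᵥ w = 0 ∧ ∀ g, Antitone g → p ⬝ᵥ g ≤ 0 := by
  obtain ⟨w, hw, hpw, hp⟩ :=
    exists_moreau_decomposition isClosed_antitoneCone.isComplete (WithLp.toLp 2 c)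
  simp only [EuclideanSpace.inner_eq_star_dotProduct, star_trivial] at hpw hp
  exact ⟨w.ofLp, c - w.ofLp, (add_sub_cancel _ _).symm, hw, (dotProduct_comm _ _).trans hpw,
    fun g hg => (dotProduct_comm _ _).trans_le (hp (WithLp.toLp 2 g) hg)⟩

/-- Perturbing `w` by a small multiple of `g` keeps it weakly decreasing, so `p` cannot be negative
on `g`. -/
lemma dotProduct_eq_zero_of_comonotone [Preorder ι] {w p g : ι → ℝ} (hw : Antitone w)
    (hpw : p ⬝ᵥ w = 0) (hp : ∀ g, Antitone g → p ⬝ᵥ g ≤ 0) (hg : ∀ i j, w i ≤ w j → g i ≤ g j) :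
    p ⬝ᵥ g = 0 := by
  have hpert : ∀ i j, i ≤ j → ∀ᶠ ε in nhdsWithin (0 : ℝ) (Set.Ioi 0),
      (w - ε • g) j ≤ (w - ε • g) i := by
    intro i j hij
    rcases (hw hij).eq_or_lt with h | h
    · exact .of_forall fun ε => by
        simp [h, le_antisymm (hg i j h.ge) (hg j i h.le)]
    · have hlim : ∀ k, Filter.Tendsto (fun ε : ℝ => (w - ε • g) k) (nhds 0) (nhds (w k)) := by
        intro k
        have hcont : Continuous fun ε : ℝ => w k - ε * g k := by fun_prop
        simpa using hcont.tendsto 0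
      exact nhdsWithin_le_nhds (((hlim j).eventually_lt (hlim i) h).mono fun _ => le_of_lt)
  obtain ⟨ε, hanti, hε⟩ : ∃ ε : ℝ, Antitone (w - ε • g) ∧ 0 < ε := by
    have hall := Filter.eventually_all.2 fun i => Filter.eventually_all.2 fun j =>
      Filter.eventually_all.2 (hpert i j)
    obtain ⟨ε, h, hε⟩ := (hall.and self_mem_nhdsWithin).exists
    exact ⟨ε, fun i j hij => h i j hij, hε⟩
  have hneg : ε * (p ⬝ᵥ g) ≥ 0 := by
    simpa [dotProduct_sub, hpw] using hp _ hanti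
  exact le_antisymm (hp g fun i j hij => hg j i (hw hij)) (nonneg_of_mul_nonneg_right hneg hε)

/-- The functional `g ↦ ∑ (g j - g i)` over the pairs `i ≤ j` on which `w` takes equal values. Among
weakly decreasing `g` it is maximal exactly at those that are constant on the level sets of `w`. -/
noncomputable def levelDrop [LinearOrder ι] (w : ι → ℝ) : ι → ℝ :=
  ∑ q : ι × ι with q.1 ≤ q.2 ∧ w q.1 = w q.2, (Pi.single q.2 1 - Pi.single q.1 1)

lemma levelDrop_dotProduct [LinearOrder ι] (w g : ι → ℝ) :
    levelDrop w ⬝ᵥ g = ∑ q : ι × ι with q.1 ≤ q.2 ∧ w q.1 = w q.2, (g q.2 - g q.1) := by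
  simp only [levelDrop, sum_dotProduct, sub_dotProduct, single_one_dotProduct]

lemma levelDrop_dotProduct_nonpos [LinearOrder ι] (w : ι → ℝ) {g : ι → ℝ} (hg : Antitone g) :
    levelDrop w ⬝ᵥ g ≤ 0 := by
  rw [levelDrop_dotProduct]
  exact Finset.sum_nonpos fun q hq => sub_nonpos.2 (hg (Finset.mem_filter.1 hq).2.1)

lemma levelDrop_dotProduct_eq_zero_iff [LinearOrder ι] {w g : ι → ℝ} (hg : Antitone g) :
    levelDrop w ⬝ᵥ g = 0 ↔ g.FactorsThrough w := by
  rw [levelDrop_dotProduct, Finset.sum_eq_zero_iff_of_nonpos fun q hq =>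
    sub_nonpos.2 (hg (Finset.mem_filter.1 hq).2.1)]
  simp only [Finset.mem_filter, Finset.mem_univ, true_and, sub_eq_zero, Prod.forall]
  constructor
  · intro h i j hij
    rcases le_total i j with hle | hle
    · exact (h i j ⟨hle, hij⟩).symm
    · exact h j i ⟨hle, hij.symm⟩
  · rintro h i j ⟨-, hij⟩
    exact h hij.symm

/-- The level set of `w` at height `s`. -/
noncomputable def level (w : ι → ℝ) (s : ℝ) : Finset ι :=
  {i | w i = s}

lemma mem_level {w : ι → ℝ} {s : ℝ} {i : ι} : i ∈ level w s ↔ w i = s := by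
  simp [level]

lemma card_level_mul_eq {w x : ι → ℝ} {a i : ι} (hx : x.FactorsThrough w)
    (hsupp : ∀ k, |w k| ≠ |w a| → x k = 0) (hwx : w ⬝ᵥ x = 0) (hi : w i = -w a) :
    (level w (w a)).card * x a = (level w (w i)).card * x i := by
  rcases eq_or_ne (w a) 0 with ha | ha
  · have hia : w i = w a := by rw [hi, ha, neg_zero]
    rw [hia, hx hia]
  classical
  have hterm : ∀ k, w k * x k = (if k ∈ level w (w a) then w a * x a else 0) +
      if k ∈ level w (w i) then w i * x i else 0 := by
    intro k
    simp only [mem_level]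
    rcases eq_or_ne (w k) (w a) with h | h
    · have hki : w k ≠ w i := fun h' => ha (by linarith)
      rw [if_pos h, if_neg hki, add_zero, h, hx h]
    · rcases eq_or_ne (w k) (w i) with h' | h'
      · rw [if_neg h, if_pos h', zero_add, h', hx h']
      · have hk : |w k| ≠ |w a| := fun e => (abs_eq_abs.1 e).elim h (hi ▸ h')
        rw [if_neg h, if_neg h', hsupp k hk, mul_zero, add_zero]
  have hsum : w a * ((level w (w a)).card * x a - (level w (w i)).card * x i) = 0 := by
    rw [← hwx, dotProduct, Finset.sum_congr rfl fun k _ => hterm k, Finset.sum_add_distrib,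
      Finset.sum_ite_mem, Finset.sum_ite_mem, Finset.univ_inter, Finset.univ_inter,
      Finset.sum_const, Finset.sum_const, nsmul_eq_mul, nsmul_eq_mul, hi]
    ring
  linarith [(mul_eq_zero.1 hsum).resolve_left ha]

/-- The vectors satisfying the hypotheses on `x` form a space of dimension at most one. -/
lemma mul_eq_mul_of_supported_on_levels {w x y : ι → ℝ} {a : ι} (hx : x.FactorsThrough w)
    (hxs : ∀ k, |w k| ≠ |w a| → x k = 0) (hwx : w ⬝ᵥ x = 0) (hy : y.FactorsThrough w)
    (hys : ∀ k, |w k| ≠ |w a| → y k = 0) (hwy : w ⬝ᵥ y = 0) (i : ι) :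
    x i * y a = x a * y i := by
  by_cases habs : |w i| = |w a|
  · rcases abs_eq_abs.1 habs with hi | hi
    · rw [hx hi, hy hi]
    · have hcard : ((level w (w i)).card : ℝ) ≠ 0 :=
        Nat.cast_ne_zero.2 (Finset.card_ne_zero_of_mem (mem_level.2 rfl))
      refine mul_left_cancel₀ hcard ?_
      linear_combination x a * card_level_mul_eq hy hys hwy hi -
        y a * card_level_mul_eq hx hxs hwx hi
  · rw [hxs i habs, hys i habs, zero_mul, mul_zero]

end AntitoneVectors

section Degrees

variable {V : Type*} {G E F : SimpleGraph V}

lemma exists_sdiff_adj (h : E ≤ F) (hne : E ≠ F) : ∃ i j, (F \ E).Adj i j :=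
  SimpleGraph.ne_bot_iff_exists_adj.1 (sdiff_eq_bot_iff.not.2 fun h' => hne (h.antisymm h'))

variable [Fintype V]

lemma map_swap_neighborFinset_subset [DecidableEq V] [DecidableRel G.Adj] {i k : V}
    (h : ∀ l, l ≠ i → G.Adj k l → G.Adj i l) :
    (G.neighborFinset k).map (Equiv.swap i k).toEmbedding ⊆ G.neighborFinset i := by
  intro x hx
  obtain ⟨l, hl, rfl⟩ := Finset.mem_map.1 hx
  rw [SimpleGraph.mem_neighborFinset] at hl ⊢
  rcases eq_or_ne l i with rfl | hli
  · simpa using hl.symm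
  · simpa [Equiv.swap_apply_of_ne_of_ne hli hl.ne'] using h l hli hl

lemma degree_le_degree_of_adj [DecidableRel G.Adj] {i k : V}
    (h : ∀ l, l ≠ i → G.Adj k l → G.Adj i l) :
    G.degree k ≤ G.degree i := by
  classical
  simpa using Finset.card_le_card (map_swap_neighborFinset_subset h)

lemma adj_of_degree_le [DecidableRel G.Adj] {i k j : V}
    (h : ∀ l, l ≠ i → G.Adj k l → G.Adj i l)
    (hdeg : G.degree i ≤ G.degree k) (hkj : k ≠ j) (hij : G.Adj i j) : G.Adj k j := by
  classical
  have hnbr := Finset.eq_of_subset_of_card_le (map_swap_neighborFinset_subset h) (by simpa)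
  have hji := hij.ne'
  rw [← G.mem_neighborFinset, ← hnbr, Finset.mem_map_equiv, Equiv.symm_swap,
    Equiv.swap_apply_of_ne_of_ne hji hkj.symm, G.mem_neighborFinset] at hij
  exact hij

lemma degree_add_degree_sdiff [DecidableRel E.Adj] [DecidableRel F.Adj] (h : E ≤ F) (i : V) :
    E.degree i + (F \ E).degree i = F.degree i := by
  classical
  rw [← SimpleGraph.card_neighborFinset_eq_degree, ← SimpleGraph.card_neighborFinset_eq_degree,
    ← SimpleGraph.card_neighborFinset_eq_degree, ← Finset.card_union_of_disjoint]
  · congr 1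
    ext j
    simp only [Finset.mem_union, SimpleGraph.mem_neighborFinset, SimpleGraph.sdiff_adj]
    have := @h i j
    tauto
  · simp only [Finset.disjoint_left, SimpleGraph.mem_neighborFinset, SimpleGraph.sdiff_adj]
    tauto

end Degrees

section DegreeSequences

variable {n : ℕ} {G E F : SimpleGraph (Fin n)}

lemma degreeSequence_apply (G : SimpleGraph (Fin n)) [DecidableRel G.Adj] (i : Fin n) :
    degreeSequence G i = G.degree i := by
  rw [degreeSequence]
  congr!

lemma degreeSequence_eq_zero_iff {i : Fin n} : degreeSequence G i = 0 ↔ ∀ j, ¬G.Adj i j := by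
  classical
  rw [degreeSequence_apply, Nat.cast_eq_zero, ← not_exists, ← G.degree_pos_iff_exists_adj,
    Nat.pos_iff_ne_zero, not_not]

lemma degreeSequence_nonneg (G : SimpleGraph (Fin n)) : 0 ≤ degreeSequence G := fun _ =>
  Nat.cast_nonneg _

lemma degreeSequence_mono : Monotone (degreeSequence (n := n)) := fun _ _ h _ => by
  classical exact Nat.cast_le.2 (SimpleGraph.degree_le_of_le h)

lemma degreeSequence_sdiff (h : E ≤ F) :
    degreeSequence (F \ E) = degreeSequence F - degreeSequence E := by
  classical
  funext i
  simp only [Pi.sub_apply, degreeSequence_apply, ← degree_add_degree_sdiff h i, Nat.cast_add,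
    add_sub_cancel_left]

lemma degreeSequence_comap (G : SimpleGraph (Fin n)) (σ : Equiv.Perm (Fin n)) :
    degreeSequence (G.comap σ) = degreeSequence G ∘ σ := by
  classical
  funext i
  exact congrArg Nat.cast ((SimpleGraph.Iso.comap σ G).degree_eq i).symm

lemma mem_degreePartitions_iff {d : Fin n → ℝ} :
    d ∈ degreePartitions n ↔ Antitone d ∧ ∃ G, degreeSequence G = d := by
  constructor
  · rintro ⟨G, hd, σ, rfl⟩
    exact ⟨hd, G.comap σ, degreeSequence_comap G σ⟩
  · rintro ⟨hd, G, rfl⟩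
    exact ⟨G, hd, 1, rfl⟩

end DegreeSequences

section ShiftedGraphs

/-- A graph on an ordered vertex set is shifted if moving an end of an edge down to a smaller vertex
always yields an edge again. -/
def IsShifted {V : Type*} [LE V] (G : SimpleGraph V) : Prop :=
  ∀ ⦃i k j⦄, k ≤ i → k ≠ j → G.Adj i j → G.Adj k j

lemma IsShifted.antitone_degree {V : Type*} [Fintype V] [Preorder V] {G : SimpleGraph V}
    [DecidableRel G.Adj] (hG : IsShifted G) : Antitone fun i => G.degree i := fun _ _ hij =>
  degree_le_degree_of_adj fun _ hl => hG hij hl.symm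

/-- Neither a dominating nor an isolated vertex exists on an alternating 4-cycle. -/
lemma IsThreshold.adj_or_adj {V : Type*} {G : SimpleGraph V} (hG : IsThreshold G) {i j k l : V}
    (hij : G.Adj i j) (hkl : G.Adj k l) (hkj : k ≠ j) (hil : i ≠ l) :
    G.Adj k j ∨ G.Adj i l := by
  by_contra! h
  obtain ⟨⟨v, hv⟩, hdom | hiso⟩ := hG {i, j, k, l} ⟨i, by simp⟩
  · simp only [IsDominatingVertex, Subtype.forall, ne_eq, Subtype.mk.injEq,
      SimpleGraph.comap_adj, Function.Embedding.subtype_apply] at hdom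
    rcases hv with rfl | rfl | rfl | rfl
    · exact h.2 (hdom l (by simp) hil.symm)
    · exact h.1 (hdom k (by simp) hkj).symm
    · exact h.1 (hdom j (by simp) hkj.symm)
    · exact h.2 (hdom i (by simp) hil).symm
  · simp only [IsIsolatedVertex, Subtype.forall, SimpleGraph.comap_adj,
      Function.Embedding.subtype_apply] at hiso
    rcases hv with rfl | rfl | rfl | rfl
    · exact hiso j (by simp) hij
    · exact hiso i (by simp) hij.symm
    · exact hiso l (by simp) hkl
    · exact hiso k (by simp) hkl.symm

variable {n : ℕ} {G E F : SimpleGraph (Fin n)} {i j : Fin n}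

lemma IsThreshold.isShifted_comap (hG : IsThreshold G) {σ : Equiv.Perm (Fin n)}
    (hσ : Antitone (degreeSequence (G.comap σ))) : IsShifted (G.comap σ) := by
  classical
  intro i k j hki hkj hij
  by_contra hn
  refine hn (adj_of_degree_le (fun l hl hkl => ?_) (Nat.cast_le.1 (hσ hki)) hkj hij)
  exact (hG.adj_or_adj hij hkl (σ.injective.ne hkj) (σ.injective.ne hl.symm)).resolve_left hn

lemma exists_isShifted_of_mem_thresholdPartitions {d : Fin n → ℝ}
    (hd : d ∈ thresholdPartitions n) : ∃ G, IsShifted G ∧ degreeSequence G = d := by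
  obtain ⟨G, hG, hanti, σ, rfl⟩ := hd
  rw [← degreeSequence_comap] at hanti ⊢
  exact ⟨G.comap σ, hG.isShifted_comap hanti, rfl⟩

namespace IsShifted

lemma antitone_degreeSequence (hG : IsShifted G) : Antitone (degreeSequence G) := fun _ _ hij => by
  classical exact Nat.cast_le.2 (hG.antitone_degree hij)

lemma degreeSequence_mem_degreePartitions (hG : IsShifted G) :
    degreeSequence G ∈ degreePartitions n :=
  mem_degreePartitions_iff.2 ⟨hG.antitone_degreeSequence, G, rfl⟩

lemma adj_iff_le_degree [DecidableRel G.Adj] (hG : IsShifted G) (hij : i < j) :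
    G.Adj i j ↔ (j : ℕ) ≤ G.degree i := by
  constructor
  · intro h
    have hsub : (Finset.Iic j).erase i ⊆ G.neighborFinset i := fun k hk => by
      obtain ⟨hki, hkj⟩ := Finset.mem_erase.1 hk
      exact (G.mem_neighborFinset i k).2 (hG (Finset.mem_Iic.1 hkj) hki h.symm).symm
    simpa [hij.le] using Finset.card_le_card hsub
  · contrapose!
    intro h
    have hsub : G.neighborFinset i ⊆ (Finset.Iio j).erase i := fun k hk => by
      rw [G.mem_neighborFinset] at hk
      exact Finset.mem_erase.2 ⟨hk.ne', Finset.mem_Iio.2 <| lt_of_not_ge fun hjk =>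
        h (hG hjk hij.ne' hk.symm).symm⟩
    have := Finset.card_le_card hsub
    simp only [Finset.card_erase_of_mem (Finset.mem_Iio.2 hij), Fin.card_Iio,
      G.card_neighborFinset_eq_degree] at this
    have := Fin.lt_def.1 hij
    omega

lemma adj_iff_lt_degree [DecidableRel G.Adj] (hG : IsShifted G) (hij : i < j) :
    G.Adj i j ↔ (i : ℕ) < G.degree j := by
  constructor
  · intro h
    have hsub : Finset.Iic i ⊆ G.neighborFinset j := fun k hk =>
      have hki := Finset.mem_Iic.1 hk
      (G.mem_neighborFinset j k).2 (hG hki (hki.trans_lt hij).ne h).symm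
    simpa [Nat.succ_le_iff] using Finset.card_le_card hsub
  · contrapose!
    intro h
    have hsub : G.neighborFinset j ⊆ Finset.Iio i := fun k hk => by
      rw [G.mem_neighborFinset] at hk
      exact Finset.mem_Iio.2 <| lt_of_not_ge fun hik => h (hG hik hij.ne hk.symm)
    simpa using Finset.card_le_card hsub

lemma le_of_degreeSequence_le (hE : IsShifted E) (hF : IsShifted F)
    (h : degreeSequence E ≤ degreeSequence F) : E ≤ F := by
  classical
  have hlt : ∀ i j, i < j → E.Adj i j → F.Adj i j := fun i j hij hadj =>
    (hF.adj_iff_le_degree hij).2 <|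
      ((hE.adj_iff_le_degree hij).1 hadj).trans (Nat.cast_le.1 (h i))
  intro i j hadj
  rcases hadj.ne.lt_or_gt with hij | hij
  · exact hlt i j hij hadj
  · exact (hlt j i hij hadj.symm).symm

end IsShifted

/-- The degree of `i` minus its index. On a shifted graph the sign of `excess G i + excess G j`
tells whether `i` and `j` are adjacent, so this weight recovers the graph from its degrees. -/
noncomputable def excess (G : SimpleGraph (Fin n)) (i : Fin n) : ℝ :=
  degreeSequence G i - i

lemma IsShifted.excess_pos_of_adj (hG : IsShifted G) (hij : G.Adj i j) :
    0 < excess G i + excess G j := by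
  classical
  wlog hlt : i < j generalizing i j
  · rw [add_comm]
    exact this hij.symm (hij.ne.lt_or_gt.resolve_left hlt)
  have hi : ((j : ℕ) : ℝ) ≤ G.degree i := Nat.cast_le.2 ((hG.adj_iff_le_degree hlt).1 hij)
  have hj : ((i : ℕ) : ℝ) < G.degree j := Nat.cast_lt.2 ((hG.adj_iff_lt_degree hlt).1 hij)
  simp only [excess, degreeSequence_apply]
  linarith

lemma IsShifted.excess_neg_of_not_adj (hG : IsShifted G) (hne : i ≠ j) (hij : ¬G.Adj i j) :
    excess G i + excess G j < 0 := by
  classical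
  wlog hlt : i < j generalizing i j
  · rw [add_comm]
    exact this hne.symm (fun h => hij h.symm) (hne.lt_or_gt.resolve_left hlt)
  have hi : (G.degree i : ℝ) < (j : ℕ) :=
    Nat.cast_lt.2 (not_le.1 fun h => hij ((hG.adj_iff_le_degree hlt).2 h))
  have hj : (G.degree j : ℝ) ≤ (i : ℕ) :=
    Nat.cast_le.2 (not_lt.1 fun h => hij ((hG.adj_iff_lt_degree hlt).2 h))
  simp only [excess, degreeSequence_apply]
  linarith

end ShiftedGraphs

section WeightGraphs

/-- The graph whose edges are the pairs of positive `w`-weight, together with those pairs of weight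
zero whose ends have absolute weight in `S`. As `S` varies, these are maximizers of the linear
functional `w` among all degree sequences. -/
def weightGraph {V : Type*} (w : V → ℝ) (S : Set ℝ) : SimpleGraph V where
  Adj i j := i ≠ j ∧ (0 < w i + w j ∨ w i + w j = 0 ∧ |w i| ∈ S)
  symm := ⟨fun i j ⟨hne, h⟩ => ⟨hne.symm, by
    rw [add_comm (w j)]
    exact h.imp_right fun ⟨h0, hS⟩ => ⟨h0, by rwa [eq_neg_of_add_eq_zero_right h0, abs_neg]⟩⟩⟩

variable {V : Type*} {w : V → ℝ} {S : Set ℝ} {G : SimpleGraph V} {i j k : V}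

lemma weightGraph_adj :
    (weightGraph w S).Adj i j ↔ i ≠ j ∧ (0 < w i + w j ∨ w i + w j = 0 ∧ |w i| ∈ S) := Iff.rfl

lemma weightGraph_empty_adj : (weightGraph w ∅).Adj i j ↔ i ≠ j ∧ 0 < w i + w j := by
  simp [weightGraph_adj]

lemma weightGraph_univ_adj : (weightGraph w Set.univ).Adj i j ↔ i ≠ j ∧ 0 ≤ w i + w j := by
  simp [weightGraph_adj, le_iff_lt_or_eq, eq_comm]

lemma weightGraph_mono : Monotone (weightGraph w) := fun _ _ hST _ _ h =>
  ⟨h.1, h.2.imp_right fun h0 => ⟨h0.1, hST h0.2⟩⟩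

lemma weightGraph_empty_eq (hpos : ∀ i j, G.Adj i j → 0 < w i + w j)
    (hneg : ∀ i j, i ≠ j → ¬G.Adj i j → w i + w j ≤ 0) : weightGraph w ∅ = G := by
  ext i j
  rw [weightGraph_empty_adj]
  exact ⟨fun h => by_contra fun hn => (hneg i j h.1 hn).not_gt h.2, fun h => ⟨h.ne, hpos i j h⟩⟩

lemma weightGraph_univ_eq (hpos : ∀ i j, G.Adj i j → 0 ≤ w i + w j)
    (hneg : ∀ i j, i ≠ j → ¬G.Adj i j → w i + w j < 0) : weightGraph w Set.univ = G := by
  ext i j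
  rw [weightGraph_univ_adj]
  exact ⟨fun h => by_contra fun hn => (hneg i j h.1 hn).not_ge h.2, fun h => ⟨h.ne, hpos i j h⟩⟩

lemma weightGraph_adj_of_le (hik : w i ≤ w k) (hkj : k ≠ j) (hij : (weightGraph w S).Adj i j) :
    (weightGraph w S).Adj k j := by
  refine ⟨hkj, ?_⟩
  rcases hik.eq_or_lt with h | h
  · exact h ▸ hij.2
  · have := (weightGraph_univ_adj.1 (weightGraph_mono (Set.subset_univ S) hij)).2
    exact Or.inl (by linarith)

lemma weightGraph_degree_le [Fintype V] [DecidableRel (weightGraph w S).Adj]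
    (hik : w i ≤ w k) :
    (weightGraph w S).degree i ≤ (weightGraph w S).degree k :=
  degree_le_degree_of_adj fun _ hl => weightGraph_adj_of_le hik hl.symm

lemma isShifted_weightGraph [Preorder V] (hw : Antitone w) :
    IsShifted (weightGraph w S) := fun _ _ _ hki => weightGraph_adj_of_le (hw hki)

open Classical in
lemma ite_adj_le (w : V → ℝ) (S : Set ℝ) (G : SimpleGraph V) (i j : V) :
    (if G.Adj i j then w i + w j else 0) ≤ if (weightGraph w S).Adj i j then w i + w j else 0 := by
  split_ifs with hG hW hW
  · exact le_rfl
  · exact not_lt.1 fun h => hW ⟨hG.ne, Or.inl h⟩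
  · exact (weightGraph_univ_adj.1 (weightGraph_mono (Set.subset_univ S) hW)).2
  · exact le_rfl

open Classical in
lemma ite_adj_eq_iff :
    ((if G.Adj i j then w i + w j else 0) = if (weightGraph w S).Adj i j then w i + w j else 0) ↔
      ((weightGraph w ∅).Adj i j → G.Adj i j) ∧
        (G.Adj i j → (weightGraph w Set.univ).Adj i j) := by
  have h0 : (weightGraph w ∅).Adj i j → (weightGraph w S).Adj i j :=
    fun h => weightGraph_mono (Set.empty_subset S) h
  have h1 : (weightGraph w S).Adj i j → (weightGraph w Set.univ).Adj i j :=
    fun h => weightGraph_mono (Set.subset_univ S) h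
  have hne : G.Adj i j → i ≠ j := SimpleGraph.Adj.ne
  rw [weightGraph_empty_adj] at h0 ⊢
  rw [weightGraph_univ_adj] at h1 ⊢
  split_ifs <;> grind

end WeightGraphs

section DegreeFunctionals

variable {n : ℕ} {w : Fin n → ℝ} {S : Set ℝ} {G : SimpleGraph (Fin n)}

lemma weightGraph_degreeSequence_le {i k : Fin n} (hik : w i ≤ w k) :
    degreeSequence (weightGraph w S) i ≤ degreeSequence (weightGraph w S) k := by
  classical exact Nat.cast_le.2 (weightGraph_degree_le hik)

lemma two_mul_dotProduct_degreeSequence (w : Fin n → ℝ) (G : SimpleGraph (Fin n))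
    [DecidableRel G.Adj] :
    2 * (w ⬝ᵥ degreeSequence G) =
      ∑ q : Fin n × Fin n, if G.Adj q.1 q.2 then w q.1 + w q.2 else 0 := by
  have hdeg : ∀ i, degreeSequence G i = ∑ j, if G.Adj i j then 1 else 0 := fun i => by
    rw [Finset.sum_boole, ← G.neighborFinset_eq_filter, G.card_neighborFinset_eq_degree,
      degreeSequence_apply]
  have hleft : w ⬝ᵥ degreeSequence G = ∑ i, ∑ j, if G.Adj i j then w i else 0 := by
    simp only [dotProduct, hdeg, Finset.mul_sum, mul_ite, mul_one, mul_zero]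
  have hright : w ⬝ᵥ degreeSequence G = ∑ i, ∑ j, if G.Adj i j then w j else 0 := by
    rw [hleft, Finset.sum_comm]
    simp only [G.adj_comm]
  rw [two_mul]
  nth_rewrite 1 [hleft]
  rw [hright, Fintype.sum_prod_type, ← Finset.sum_add_distrib]
  refine Finset.sum_congr rfl fun i _ => ?_
  rw [← Finset.sum_add_distrib]
  exact Finset.sum_congr rfl fun j _ => by split_ifs <;> simp

lemma dotProduct_degreeSequence_le (w : Fin n → ℝ) (S : Set ℝ) (G : SimpleGraph (Fin n)) :
    w ⬝ᵥ degreeSequence G ≤ w ⬝ᵥ degreeSequence (weightGraph w S) := by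
  classical
  refine le_of_mul_le_mul_left ?_ (two_pos (α := ℝ))
  rw [two_mul_dotProduct_degreeSequence, two_mul_dotProduct_degreeSequence]
  exact Finset.sum_le_sum fun q _ => ite_adj_le w S G q.1 q.2

lemma dotProduct_degreeSequence_eq_iff :
    w ⬝ᵥ degreeSequence G = w ⬝ᵥ degreeSequence (weightGraph w S) ↔
      weightGraph w ∅ ≤ G ∧ G ≤ weightGraph w Set.univ := by
  classical
  rw [← mul_right_inj' (two_ne_zero (α := ℝ)), two_mul_dotProduct_degreeSequence,
    two_mul_dotProduct_degreeSequence,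
    Finset.sum_eq_sum_iff_of_le fun q _ => ite_adj_le w S G q.1 q.2]
  simp only [Finset.mem_univ, true_imp_iff, Prod.forall, ite_adj_eq_iff, SimpleGraph.le_iff_adj,
    forall_and]

lemma IsShifted.weightGraph_excess_empty (hG : IsShifted G) : weightGraph (excess G) ∅ = G :=
  weightGraph_empty_eq (fun _ _ => hG.excess_pos_of_adj)
    fun _ _ hne h => (hG.excess_neg_of_not_adj hne h).le

lemma IsShifted.weightGraph_excess_univ (hG : IsShifted G) :
    weightGraph (excess G) Set.univ = G :=
  weightGraph_univ_eq (fun _ _ h => (hG.excess_pos_of_adj h).le)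
    fun _ _ => hG.excess_neg_of_not_adj

lemma IsShifted.excess_dotProduct_le (hG : IsShifted G) (H : SimpleGraph (Fin n)) :
    excess G ⬝ᵥ degreeSequence H ≤ excess G ⬝ᵥ degreeSequence G := by
  simpa only [hG.weightGraph_excess_empty] using dotProduct_degreeSequence_le (excess G) ∅ H

lemma IsShifted.excess_dotProduct_eq_iff (hG : IsShifted G) {H : SimpleGraph (Fin n)} :
    excess G ⬝ᵥ degreeSequence H = excess G ⬝ᵥ degreeSequence G ↔ H = G := by
  have := dotProduct_degreeSequence_eq_iff (w := excess G) (S := ∅) (G := H)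
  rw [hG.weightGraph_excess_empty, hG.weightGraph_excess_univ] at this
  rw [this, ← le_antisymm_iff, eq_comm]

lemma IsShifted.eq_of_degreeSequence_eq (hG : IsShifted G) {H : SimpleGraph (Fin n)}
    (h : degreeSequence H = degreeSequence G) : H = G :=
  hG.excess_dotProduct_eq_iff.1 (by rw [h])

end DegreeFunctionals

section Faces

variable {n : ℕ} {G E F : SimpleGraph (Fin n)} {w : Fin n → ℝ}

/-- The linear functional `c ⬝ᵥ ·`. -/
noncomputable def dotFunctional (n : ℕ) : (Fin n → ℝ) ≃ₗ[ℝ] StrongDual ℝ (Fin n → ℝ) :=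
  (dotProductEquiv ℝ (Fin n)).trans LinearMap.toContinuousLinearMap

lemma dotFunctional_apply (c x : Fin n → ℝ) : dotFunctional n c x = c ⬝ᵥ x := rfl

lemma IsShifted.mem_extremePoints (hG : IsShifted G) :
    degreeSequence G ∈ (degreePartitionPolytope n).extremePoints ℝ := by
  have hexp := isExposed_convexHull_sep (S := degreePartitions n)
    (l := dotFunctional n (excess G)) (M := excess G ⬝ᵥ degreeSequence G) fun d hd => by
      obtain ⟨-, H, rfl⟩ := mem_degreePartitions_iff.1 hd
      exact hG.excess_dotProduct_le H
  have hsep : {d ∈ degreePartitions n | dotFunctional n (excess G) d =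
      excess G ⬝ᵥ degreeSequence G} = {degreeSequence G} := by
    refine Set.eq_singleton_iff_unique_mem.2 ⟨⟨hG.degreeSequence_mem_degreePartitions, rfl⟩, ?_⟩
    rintro d ⟨hd, heq⟩
    obtain ⟨-, H, rfl⟩ := mem_degreePartitions_iff.1 hd
    rw [hG.excess_dotProduct_eq_iff.1 heq]
  rw [hsep, convexHull_singleton] at hexp
  exact isExtreme_singleton.1 hexp.isExtreme

/-- `w` is a weight whose maximizers among the graphs are the graphs between `E` and `F`, where the
pairs of weight zero, which are the edges of `F` that are not in `E`, all have the same absolute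
weights. These are the weights that describe the edges of the polytope. -/
structure IsEdgeWeight (w : Fin n → ℝ) (E F : SimpleGraph (Fin n)) : Prop where
  weightGraph_empty : weightGraph w ∅ = E
  weightGraph_univ : weightGraph w Set.univ = F
  abs_eq : ∀ ⦃i j k l⦄, i ≠ j → w i + w j = 0 → k ≠ l → w k + w l = 0 → |w i| = |w k|

namespace IsEdgeWeight

lemma le (h : IsEdgeWeight w E F) : E ≤ F := by
  rw [← h.weightGraph_empty, ← h.weightGraph_univ]
  exact weightGraph_mono (Set.empty_subset _)

lemma sdiff_adj (h : IsEdgeWeight w E F) {i j : Fin n} :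
    (F \ E).Adj i j ↔ i ≠ j ∧ w i + w j = 0 := by
  rw [SimpleGraph.sdiff_adj, ← h.weightGraph_empty, ← h.weightGraph_univ, weightGraph_empty_adj,
    weightGraph_univ_adj, le_antisymm_iff]
  grind

lemma degreeSequence_sdiff_eq_zero (h : IsEdgeWeight w E F) {a b : Fin n} (hab : (F \ E).Adj a b)
    {H : SimpleGraph (Fin n)} (hHF : H ≤ F) {k : Fin n} (hk : |w k| ≠ |w a|) :
    degreeSequence (H \ E) k = 0 := by
  rw [degreeSequence_eq_zero_iff]
  intro l hl
  have hkl := h.sdiff_adj.1 (sdiff_le_sdiff_right hHF hl)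
  have hab' := h.sdiff_adj.1 hab
  exact hk (h.abs_eq hkl.1 hkl.2 hab'.1 hab'.2)

lemma factorsThrough (h : IsEdgeWeight w E F) :
    (degreeSequence E).FactorsThrough w ∧ (degreeSequence F).FactorsThrough w := by
  rw [← h.weightGraph_empty, ← h.weightGraph_univ]
  constructor <;>
  · intro i j hij
    exact le_antisymm (weightGraph_degreeSequence_le hij.le) (weightGraph_degreeSequence_le hij.ge)

lemma dotProduct_le (h : IsEdgeWeight w E F) (H : SimpleGraph (Fin n)) :
    w ⬝ᵥ degreeSequence H ≤ w ⬝ᵥ degreeSequence E := by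
  rw [← h.weightGraph_empty]
  exact dotProduct_degreeSequence_le w ∅ H

lemma dotProduct_eq_iff (h : IsEdgeWeight w E F) {H : SimpleGraph (Fin n)} :
    w ⬝ᵥ degreeSequence H = w ⬝ᵥ degreeSequence E ↔ E ≤ H ∧ H ≤ F := by
  rw [← h.weightGraph_empty, ← h.weightGraph_univ]
  exact dotProduct_degreeSequence_eq_iff

lemma sdiff_factorsThrough_and_dotProduct (h : IsEdgeWeight w E F) {H : SimpleGraph (Fin n)}
    (hEH : E ≤ H) (hHF : H ≤ F) (hH : (degreeSequence H).FactorsThrough w) :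
    (degreeSequence (H \ E)).FactorsThrough w ∧ w ⬝ᵥ degreeSequence (H \ E) = 0 := by
  rw [degreeSequence_sdiff hEH, dotProduct_sub, sub_eq_zero]
  exact ⟨fun i j hij => congrArg₂ (· - ·) (hH hij) (h.factorsThrough.1 hij),
    h.dotProduct_eq_iff.2 ⟨hEH, hHF⟩⟩

lemma degreeSequence_mem_segment (h : IsEdgeWeight w E F) (hne : E ≠ F)
    {H : SimpleGraph (Fin n)} (hEH : E ≤ H) (hHF : H ≤ F)
    (hH : (degreeSequence H).FactorsThrough w) :
    degreeSequence H ∈ segment ℝ (degreeSequence E) (degreeSequence F) := by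
  obtain ⟨a, b, hab⟩ := exists_sdiff_adj h.le hne
  obtain ⟨hx, hwx⟩ := h.sdiff_factorsThrough_and_dotProduct hEH hHF hH
  obtain ⟨hy, hwy⟩ := h.sdiff_factorsThrough_and_dotProduct h.le le_rfl h.factorsThrough.2
  have hprop := mul_eq_mul_of_supported_on_levels hx
    (fun _ => h.degreeSequence_sdiff_eq_zero hab hHF) hwx hy
    (fun _ => h.degreeSequence_sdiff_eq_zero hab le_rfl) hwy
  have hya : 0 < degreeSequence (F \ E) a :=
    (degreeSequence_nonneg _ a).lt_of_ne' fun h0 => degreeSequence_eq_zero_iff.1 h0 b hab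
  rw [segment_eq_image', ← degreeSequence_sdiff h.le]
  refine ⟨degreeSequence (H \ E) a / degreeSequence (F \ E) a,
    ⟨div_nonneg (degreeSequence_nonneg _ a) hya.le, (div_le_one hya).2 ?_⟩, ?_⟩
  · exact degreeSequence_mono (sdiff_le_sdiff_right hHF) a
  · rw [← eq_sub_iff_add_eq', ← degreeSequence_sdiff hEH]
    funext i
    rw [Pi.smul_apply, smul_eq_mul, div_mul_eq_mul_div, div_eq_iff hya.ne', hprop i]

lemma add_levelDrop_dotProduct_le (h : IsEdgeWeight w E F) {H : SimpleGraph (Fin n)}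
    (hH : Antitone (degreeSequence H)) :
    (w + levelDrop w) ⬝ᵥ degreeSequence H ≤ w ⬝ᵥ degreeSequence E := by
  rw [add_dotProduct]
  linarith [h.dotProduct_le H, levelDrop_dotProduct_nonpos w hH]

lemma add_levelDrop_dotProduct_eq_iff (h : IsEdgeWeight w E F) {H : SimpleGraph (Fin n)}
    (hH : Antitone (degreeSequence H)) :
    (w + levelDrop w) ⬝ᵥ degreeSequence H = w ⬝ᵥ degreeSequence E ↔
      (E ≤ H ∧ H ≤ F) ∧ (degreeSequence H).FactorsThrough w := by
  rw [add_dotProduct, ← h.dotProduct_eq_iff, ← levelDrop_dotProduct_eq_zero_iff hH]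
  have hw := h.dotProduct_le H
  have hdrop := levelDrop_dotProduct_nonpos w hH
  constructor
  · intro hsum
    constructor <;> linarith
  · rintro ⟨hw_eq, hdrop_eq⟩
    linarith

/-- Adding `levelDrop w` to `w` discards the maximizers whose degrees are not constant on the level
sets of `w`. -/
lemma isExposed (h : IsEdgeWeight w E F) (hE : IsShifted E) (hF : IsShifted F) (hne : E ≠ F) :
    IsExposed ℝ (degreePartitionPolytope n)
      (segment ℝ (degreeSequence E) (degreeSequence F)) := by
  have hseg : segment ℝ (degreeSequence E) (degreeSequence F) =
      convexHull ℝ {d ∈ degreePartitions n | dotFunctional n (w + levelDrop w) d =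
        w ⬝ᵥ degreeSequence E} := by
    have hmaxE := (h.add_levelDrop_dotProduct_eq_iff hE.antitone_degreeSequence).2
      ⟨⟨le_rfl, h.le⟩, h.factorsThrough.1⟩
    have hmaxF := (h.add_levelDrop_dotProduct_eq_iff hF.antitone_degreeSequence).2
      ⟨⟨h.le, le_rfl⟩, h.factorsThrough.2⟩
    refine Set.Subset.antisymm
      (segment_subset_convexHull ⟨hE.degreeSequence_mem_degreePartitions, hmaxE⟩
        ⟨hF.degreeSequence_mem_degreePartitions, hmaxF⟩)
      (convexHull_min ?_ (convex_segment _ _))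
    rintro d ⟨hd, heq⟩
    obtain ⟨hanti, H, rfl⟩ := mem_degreePartitions_iff.1 hd
    obtain ⟨⟨hEH, hHF⟩, hH⟩ := (h.add_levelDrop_dotProduct_eq_iff hanti).1 heq
    exact h.degreeSequence_mem_segment hne hEH hHF hH
  rw [hseg]
  refine isExposed_convexHull_sep fun d hd => ?_
  obtain ⟨hanti, H, rfl⟩ := mem_degreePartitions_iff.1 hd
  exact h.add_levelDrop_dotProduct_le hanti

end IsEdgeWeight

/-- Weakly decreasing vectors see only the projection of a functional to the cone of weakly
decreasing weights, and the degrees of `weightGraph w S` decrease with `w`. -/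
lemma exists_antitone_weight {B : Set (Fin n → ℝ)}
    (hB : IsExposed ℝ (degreePartitionPolytope n) B) (hne : B.Nonempty) :
    ∃ w : Fin n → ℝ, Antitone w ∧ (∀ S, degreeSequence (weightGraph w S) ∈ B) ∧
      ∀ H, Antitone (degreeSequence H) → degreeSequence H ∈ B →
        weightGraph w ∅ ≤ H ∧ H ≤ weightGraph w Set.univ := by
  obtain ⟨l, rfl⟩ := hB hne
  obtain ⟨c, rfl⟩ := (dotFunctional n).surjective l
  obtain ⟨w, p, rfl, hw, hpw, hp⟩ := exists_antitone_add_polar c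
  simp only [dotFunctional_apply, add_dotProduct]
  have hpzero : ∀ S, p ⬝ᵥ degreeSequence (weightGraph w S) = 0 := fun S =>
    dotProduct_eq_zero_of_comonotone hw hpw hp fun _ _ => weightGraph_degreeSequence_le
  have hmem : ∀ S, degreeSequence (weightGraph w S) ∈ degreePartitionPolytope n := fun S =>
    subset_convexHull ℝ _ (isShifted_weightGraph hw).degreeSequence_mem_degreePartitions
  have hmax : ∀ S, ∀ y ∈ degreePartitionPolytope n,
      w ⬝ᵥ y + p ⬝ᵥ y ≤ w ⬝ᵥ degreeSequence (weightGraph w S) := by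
    intro S y hy
    rw [← add_dotProduct]
    refine convexHull_min (fun d hd => ?_)
      (convex_halfSpace_le (dotFunctional n (w + p)).toLinearMap.isLinear _) hy
    obtain ⟨hanti, H, rfl⟩ := mem_degreePartitions_iff.1 hd
    refine (add_dotProduct w p _).trans_le ?_
    linarith [dotProduct_degreeSequence_le w S H, hp _ hanti]
  refine ⟨w, hw, fun S => ⟨hmem S, fun y hy => ?_⟩, fun H hanti ⟨_, hH⟩ => ?_⟩
  · rw [hpzero, add_zero]
    exact hmax S y hy
  · refine (dotProduct_degreeSequence_eq_iff (S := ∅)).1 (le_antisymm ?_ ?_)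
    · exact dotProduct_degreeSequence_le w ∅ H
    · linarith [hH _ (hmem ∅), hpzero ∅, hp _ hanti]

lemma exists_isEdgeWeight (hE : IsShifted E) (hF : IsShifted F)
    (h : AdjacentExtremePoints (degreePartitionPolytope n) (degreeSequence E) (degreeSequence F)) :
    ∃ w, Antitone w ∧ (IsEdgeWeight w E F ∨ IsEdgeWeight w F E) := by
  obtain ⟨hEx, hFx, hne, hseg⟩ := h
  have hEF : E ≠ F := fun h => hne (congrArg _ h)
  obtain ⟨w, hw, hmem, hbetween⟩ := exists_antitone_weight hseg ⟨_, left_mem_segment ℝ _ _⟩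
  have hS : ∀ S, weightGraph w S = E ∨ weightGraph w S = F := by
    intro S
    have hext := (mem_extremePoints_iff_forall_segment.1
      (isShifted_weightGraph (S := S) hw).mem_extremePoints).2 _ hEx.1 _ hFx.1 (hmem S)
    exact hext.imp (fun h => hE.eq_of_degreeSequence_eq h.symm)
      fun h => hF.eq_of_degreeSequence_eq h.symm
  obtain ⟨hE0, hE1⟩ := hbetween E hE.antitone_degreeSequence (left_mem_segment ℝ _ _)
  obtain ⟨hF0, hF1⟩ := hbetween F hF.antitone_degreeSequence (right_mem_segment ℝ _ _)
  have hends : weightGraph w ∅ ≠ weightGraph w Set.univ := fun h =>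
    hEF ((hE1.trans (h ▸ hF0)).antisymm (hF1.trans (h ▸ hE0)))
  have hS' : ∀ S, weightGraph w S ≠ weightGraph w ∅ → weightGraph w S = weightGraph w Set.univ := by
    grind
  have habs : ∀ ⦃i j k l⦄, i ≠ j → w i + w j = 0 → k ≠ l → w k + w l = 0 → |w i| = |w k| := by
    intro i j k l hij hij0 hkl hkl0
    have huniv := hS' {|w i|} fun h => by
      have hadj : (weightGraph w {|w i|}).Adj i j := ⟨hij, Or.inr ⟨hij0, rfl⟩⟩
      rw [h] at hadj
      exact (weightGraph_empty_adj.1 hadj).2.ne' hij0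
    have hadj : (weightGraph w {|w i|}).Adj k l := huniv ▸ ⟨hkl, Or.inr ⟨hkl0, trivial⟩⟩
    exact (hadj.2.resolve_left hkl0.not_gt).2.symm
  refine ⟨w, hw, ?_⟩
  rcases hS ∅ with h0 | h0 <;> rcases hS Set.univ with h1 | h1
  · exact absurd (h0.trans h1.symm) hends
  · exact Or.inl ⟨h0, h1, habs⟩
  · exact Or.inr ⟨h0, h1, habs⟩
  · exact absurd (h0.trans h1.symm) hends

end Faces

section EdgeVectors

variable {n : ℕ} {E F : SimpleGraph (Fin n)} {w : Fin n → ℝ}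

/-- The vectors `Ω_I` for nontrivial intervals `I` and `Ω_{I,J}` for intervals `I` before `J`: up to
sign, the directions of the edges of the polytope. -/
def IsEdgeVector (v : Fin n → ℝ) : Prop :=
  (∃ I : Finset (Fin n), IsInterval I ∧ 2 ≤ I.card ∧ v = omega I) ∨
    ∃ I J : Finset (Fin n), IsInterval I ∧ IsInterval J ∧ (∀ i ∈ I, ∀ j ∈ J, i < j) ∧
      v = omegaPair I J

lemma IsInterval.nonempty {I : Finset (Fin n)} (hI : IsInterval I) : I.Nonempty := by
  obtain ⟨i, j, hij, rfl⟩ := hI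
  exact Finset.nonempty_Icc.2 hij

lemma IsEdgeVector.ne_zero {v : Fin n → ℝ} (hv : IsEdgeVector v) : v ≠ 0 := by
  obtain ⟨I, hI, hcard, rfl⟩ | ⟨I, J, hI, hJ, -, rfl⟩ := hv
  · obtain ⟨i, hi⟩ := hI.nonempty
    have hcard' : (2 : ℝ) ≤ I.card := Nat.ofNat_le_cast.2 hcard
    refine fun h => absurd (congrFun h i) ?_
    simp only [omega, hi, if_true, Pi.zero_apply]
    linarith
  · obtain ⟨i, hi⟩ := hI.nonempty
    refine fun h => absurd (congrFun h i) ?_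
    simpa [omegaPair, hi] using hJ.nonempty.ne_empty

lemma isInterval_level (hw : Antitone w) (a : Fin n) : IsInterval (level w (w a)) := by
  have hne : (level w (w a)).Nonempty := ⟨a, mem_level.2 rfl⟩
  refine ⟨_, _, Finset.min'_le_max' _ hne, ?_⟩
  ext i
  rw [Finset.mem_Icc]
  refine ⟨fun hi => ⟨Finset.min'_le _ _ hi, Finset.le_max' _ _ hi⟩, fun ⟨hmin, hmax⟩ => ?_⟩
  rw [mem_level]
  exact le_antisymm ((hw hmin).trans_eq (mem_level.1 (Finset.min'_mem _ hne)))
    ((mem_level.1 (Finset.max'_mem _ hne)).ge.trans (hw hmax))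

namespace IsEdgeWeight

lemma degreeSequence_sdiff_apply (h : IsEdgeWeight w E F) (i : Fin n) :
    degreeSequence (F \ E) i = ((level w (-w i)).erase i).card := by
  classical
  rw [degreeSequence_apply, ← SimpleGraph.card_neighborFinset_eq_degree]
  congr 2
  ext j
  rw [SimpleGraph.mem_neighborFinset, h.sdiff_adj, Finset.mem_erase, mem_level, ne_comm,
    add_comm, ← eq_neg_iff_add_eq_zero]

lemma degreeSequence_sdiff_eq_omega (h : IsEdgeWeight w E F) {a b : Fin n}
    (hab : (F \ E).Adj a b) (ha : w a = 0) :
    degreeSequence (F \ E) = omega (level w (w a)) := by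
  funext i
  by_cases hi : w i = w a
  · have hmem : i ∈ level w (w a) := mem_level.2 hi
    rw [h.degreeSequence_sdiff_apply, hi, ha, neg_zero, ← ha, omega, if_pos hmem,
      Finset.cast_card_erase_of_mem hmem]
  · rw [omega, if_neg (mt mem_level.1 hi)]
    exact h.degreeSequence_sdiff_eq_zero hab le_rfl (by rwa [ha, abs_zero, Ne, abs_eq_zero, ← ha])

lemma degreeSequence_sdiff_eq_omegaPair (h : IsEdgeWeight w E F) {a b : Fin n}
    (hab : (F \ E).Adj a b) (ha : w a ≠ 0) :
    degreeSequence (F \ E) = omegaPair (level w (w a)) (level w (w b)) := by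
  have hb : w b = -w a := eq_neg_of_add_eq_zero_right (h.sdiff_adj.1 hab).2
  have hwa : w a ≠ -w a := (self_ne_neg.2 ha)
  funext i
  rw [omegaPair]
  by_cases hi : w i = w a
  · have hnot : i ∉ level w (w b) := by rwa [mem_level, hi, hb]
    rw [if_pos (mem_level.2 hi), h.degreeSequence_sdiff_apply, hi, ← hb,
      Finset.erase_eq_of_notMem hnot]
  by_cases hi' : w i = w b
  · rw [if_neg (mt mem_level.1 hi), if_pos (mem_level.2 hi'), h.degreeSequence_sdiff_apply, hi', hb,
      neg_neg, Finset.erase_eq_of_notMem (mt mem_level.1 hi)]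
  · rw [if_neg (mt mem_level.1 hi), if_neg (mt mem_level.1 hi')]
    exact h.degreeSequence_sdiff_eq_zero hab le_rfl fun habs =>
      (abs_eq_abs.1 habs).elim hi (hb ▸ hi')

lemma isEdgeVector (h : IsEdgeWeight w E F) (hw : Antitone w) (hne : E ≠ F) :
    IsEdgeVector (degreeSequence (F \ E)) := by
  obtain ⟨a, b, hab⟩ := exists_sdiff_adj h.le hne
  have hsum := (h.sdiff_adj.1 hab).2
  wlog hle : w b ≤ w a generalizing a b
  · exact this b a hab.symm (by rwa [add_comm]) (not_le.1 hle).le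
  rcases hle.eq_or_lt with heq | hlt
  · refine Or.inl ⟨level w (w a), isInterval_level hw a, ?_,
      h.degreeSequence_sdiff_eq_omega hab (by linarith)⟩
    exact Finset.one_lt_card.2 ⟨a, mem_level.2 rfl, b, mem_level.2 heq, hab.ne⟩
  · refine Or.inr ⟨level w (w a), level w (w b), isInterval_level hw a, isInterval_level hw b, ?_,
      h.degreeSequence_sdiff_eq_omegaPair hab fun h0 => by linarith⟩
    exact fun i hi j hj => hw.reflect_lt (by rwa [mem_level.1 hi, mem_level.1 hj])

end IsEdgeWeight

end EdgeVectors

section Reflection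

variable {n : ℕ}

/-- The permutation that reverses the interval `[a, b]` and fixes all other elements. -/
def reflectIcc (a b : Fin n) : Equiv.Perm (Fin n) :=
  Function.Involutive.toPerm
    (fun x => ⟨if (a : ℕ) ≤ x ∧ (x : ℕ) ≤ b then a + b - x else x, by split_ifs <;> omega⟩) (by
      intro x
      ext
      dsimp only
      split_ifs <;> omega)

variable {a b x : Fin n}

lemma reflectIcc_of_notMem (hx : x ∉ Finset.Icc a b) : reflectIcc a b x = x :=
  Fin.ext (if_neg (Finset.mem_Icc.not.1 hx))

lemma add_reflectIcc (hx : x ∈ Finset.Icc a b) : (x : ℕ) + reflectIcc a b x = a + b := by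
  have hval : (reflectIcc a b x : ℕ) = a + b - x := if_pos (Finset.mem_Icc.1 hx)
  rw [Finset.mem_Icc] at hx
  omega

lemma reflectIcc_mem (hx : x ∈ Finset.Icc a b) : reflectIcc a b x ∈ Finset.Icc a b := by
  have := add_reflectIcc hx
  rw [Finset.mem_Icc] at hx ⊢
  omega

lemma comp_reflectIcc {α : Type*} {f : Fin n → α} {t : α} (h : ∀ x ∈ Finset.Icc a b, f x = t) :
    f ∘ reflectIcc a b = f := by
  funext x
  by_cases hx : x ∈ Finset.Icc a b
  · rw [Function.comp_apply, h _ (reflectIcc_mem hx), h x hx]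
  · rw [Function.comp_apply, reflectIcc_of_notMem hx]

end Reflection

section Symmetrization

variable {n : ℕ} {G E F : SimpleGraph (Fin n)} {w : Fin n → ℝ} {ρ : Equiv.Perm (Fin n)}
  {i j : Fin n}

lemma IsShifted.adj_apply_iff (hG : IsShifted G) (hρ : degreeSequence G ∘ ρ = degreeSequence G) :
    G.Adj (ρ i) (ρ j) ↔ G.Adj i j := by
  have hcomap : G.comap ρ = G := hG.eq_of_degreeSequence_eq (by rw [degreeSequence_comap, hρ])
  rw [← SimpleGraph.comap_adj (f := ρ), hcomap]

lemma isEdgeWeight_of_sdiff {s : ℝ} (hpos : ∀ i j, E.Adj i j → 0 < w i + w j)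
    (hneg : ∀ i j, i ≠ j → ¬F.Adj i j → w i + w j < 0)
    (hzero : ∀ i j, (F \ E).Adj i j → w i + w j = 0 ∧ |w i| = s) : IsEdgeWeight w E F := by
  have hsdiff : ∀ i j, i ≠ j → w i + w j = 0 → (F \ E).Adj i j := fun i j hne h0 =>
    ⟨by_contra fun hF => (hneg i j hne hF).ne h0, fun hE => (hpos i j hE).ne' h0⟩
  refine ⟨weightGraph_empty_eq hpos fun i j hne hE => ?_,
    weightGraph_univ_eq (fun i j hF => ?_) hneg, fun i j k l hij hij0 hkl hkl0 => ?_⟩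
  · by_cases hF : F.Adj i j
    · exact (hzero i j ⟨hF, hE⟩).1.le
    · exact (hneg i j hne hF).le
  · by_cases hE : E.Adj i j
    · exact (hpos i j hE).le
    · exact (hzero i j ⟨hF, hE⟩).1.ge
  · rw [(hzero i j (hsdiff i j hij hij0)).2, (hzero k l (hsdiff k l hkl hkl0)).2]

/-- The sum of the excesses of `E` and `F`, symmetrized under `ρ`. -/
noncomputable def symmExcess (E F : SimpleGraph (Fin n)) (ρ : Equiv.Perm (Fin n)) (i : Fin n) : ℝ :=
  excess E i + excess E (ρ i) + (excess F i + excess F (ρ i))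

lemma isEdgeWeight_symmExcess {s : ℝ} (hE : IsShifted E) (hF : IsShifted F) (hle : E ≤ F)
    (hρE : degreeSequence E ∘ ρ = degreeSequence E) (hρF : degreeSequence F ∘ ρ = degreeSequence F)
    (hzero : ∀ i j, (F \ E).Adj i j →
      symmExcess E F ρ i + symmExcess E F ρ j = 0 ∧ |symmExcess E F ρ i| = s) :
    IsEdgeWeight (symmExcess E F ρ) E F := by
  refine isEdgeWeight_of_sdiff (fun i j hij => ?_) (fun i j hne hij => ?_) hzero
  · have hF' := hle hij
    have := hE.excess_pos_of_adj hij
    have := hE.excess_pos_of_adj ((hE.adj_apply_iff hρE).2 hij)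
    have := hF.excess_pos_of_adj hF'
    have := hF.excess_pos_of_adj ((hF.adj_apply_iff hρF).2 hF')
    simp only [symmExcess]
    linarith
  · have hE' : ¬E.Adj i j := fun h => hij (hle h)
    have hne' := ρ.injective.ne hne
    have := hE.excess_neg_of_not_adj hne hE'
    have := hE.excess_neg_of_not_adj hne' ((hE.adj_apply_iff hρE).not.2 hE')
    have := hF.excess_neg_of_not_adj hne hij
    have := hF.excess_neg_of_not_adj hne' ((hF.adj_apply_iff hρF).not.2 hij)
    simp only [symmExcess]
    linarith

lemma symmExcess_apply {a b x : Fin n} (hρE : degreeSequence E ∘ ρ = degreeSequence E)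
    (hρF : degreeSequence F ∘ ρ = degreeSequence F) (hx : (x : ℕ) + ρ x = a + b) :
    symmExcess E F ρ x = 2 * (degreeSequence E x + degreeSequence F x - a - b) := by
  have hx' : (x : ℝ) + (ρ x : ℕ) = a + b := by exact_mod_cast hx
  have hEx : degreeSequence E (ρ x) = degreeSequence E x := congrFun hρE x
  have hFx : degreeSequence F (ρ x) = degreeSequence F x := congrFun hρF x
  simp only [symmExcess, excess, hEx, hFx]
  linarith

end Symmetrization

section EdgeVectorWeights

variable {n : ℕ} {E F : SimpleGraph (Fin n)}

lemma degreeSequence_ends {a b : Fin n} (hE : IsShifted E) (hF : IsShifted F)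
    (hsupp : ∀ i, degreeSequence (F \ E) i ≠ 0 → i ∈ Finset.Icc a b)
    (ha : degreeSequence (F \ E) a ≠ 0) (hb : degreeSequence (F \ E) b ≠ 0) :
    degreeSequence F a = b ∧ degreeSequence E b = a := by
  classical
  simp only [Ne, degreeSequence_eq_zero_iff, not_forall, not_not, Finset.mem_Icc] at hsupp ha hb
  obtain ⟨x, hax⟩ := ha
  obtain ⟨y, hby⟩ := hb
  have hx := hsupp x ⟨a, hax.symm⟩
  have hy := hsupp y ⟨b, hby.symm⟩
  have hab : a < b := (hx.1.lt_of_ne hax.ne).trans_le hx.2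
  have hFab : F.Adj a b := hF hy.1 hab.ne hby.1.symm
  have hEab : ¬E.Adj a b := fun h => hax.2 (hE hx.2 hax.ne' h.symm).symm
  constructor
  · refine congrArg Nat.cast (le_antisymm ?_ ((hF.adj_iff_le_degree hab).1 hFab))
    by_contra! hlt
    have hby : b < ⟨F.degree a, by simpa using F.degree_lt_card_verts a⟩ := hlt
    have hEy := fun h => hEab (hE hby.le hab.ne' (SimpleGraph.Adj.symm h)).symm
    have hFy := (hF.adj_iff_le_degree (hab.trans hby)).2 le_rfl
    exact (hsupp _ ⟨a, hFy.symm, fun h => hEy h.symm⟩).2.not_gt hby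
  · refine congrArg Nat.cast (le_antisymm (not_lt.1 ((hE.adj_iff_lt_degree hab).not.1 hEab)) ?_)
    by_contra! hlt
    have hya : ⟨E.degree b, hlt.trans a.2⟩ < a := hlt
    have hEy := (hE.adj_iff_lt_degree (hya.trans hab)).not.2 (lt_irrefl _)
    exact (hsupp _ ⟨b, hF hya.le (hya.trans hab).ne hFab, hEy⟩).1.not_gt hya

lemma cast_card_Icc {a b : Fin n} (hab : a ≤ b) : ((Finset.Icc a b).card : ℝ) = b + 1 - a := by
  rw [Fin.card_Icc, Nat.cast_sub (by omega), Nat.cast_add_one]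

lemma forall_mem_Icc_eq_of_antitone {ι : Type*} [Preorder ι] [LocallyFiniteOrder ι] {f g : ι → ℝ}
    {x y : ι} {p q : ℝ} (hf : Antitone f) (hg : Antitone g)
    (hdiff : ∀ i ∈ Finset.Icc x y, g i = f i + (q - p)) (hgx : g x ≤ q) (hfy : p ≤ f y) :
    ∀ i ∈ Finset.Icc x y, f i = p ∧ g i = q := by
  intro i hi
  obtain ⟨hxi, hiy⟩ := Finset.mem_Icc.1 hi
  constructor <;> linarith [hf hiy, hg hxi, hdiff i hi]

lemma degreeSequence_of_sdiff_eq_omega {a b : Fin n} (hE : IsShifted E) (hF : IsShifted F)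
    (hle : E ≤ F) (hab : a < b) (h : degreeSequence (F \ E) = omega (Finset.Icc a b)) :
    ∀ i ∈ Finset.Icc a b, degreeSequence E i = a ∧ degreeSequence F i = b := by
  have hdiff : ∀ i ∈ Finset.Icc a b, degreeSequence F i = degreeSequence E i + (b - a) := by
    intro i hi
    have hsdiff := congrFun (degreeSequence_sdiff hle) i
    rw [h, omega, if_pos hi, cast_card_Icc hab.le, Pi.sub_apply] at hsdiff
    linarith
  have hpos : ∀ i ∈ Finset.Icc a b, degreeSequence (F \ E) i ≠ 0 := by
    intro i hi
    have hab' : ((a : ℕ) : ℝ) < b := Nat.cast_lt.2 hab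
    rw [h, omega, if_pos hi, cast_card_Icc hab.le]
    linarith
  have ha := Finset.left_mem_Icc.2 hab.le
  have hb := Finset.right_mem_Icc.2 hab.le
  obtain ⟨hFa, hEb⟩ := degreeSequence_ends hE hF
    (fun i hi => by_contra fun hi' => hi (by rw [h, omega, if_neg hi'])) (hpos a ha) (hpos b hb)
  exact forall_mem_Icc_eq_of_antitone hE.antitone_degreeSequence hF.antitone_degreeSequence hdiff
    hFa.le hEb.ge

lemma exists_isEdgeWeight_of_sdiff_eq_omega {a b : Fin n} (hE : IsShifted E) (hF : IsShifted F)
    (hle : E ≤ F) (hab : a < b) (h : degreeSequence (F \ E) = omega (Finset.Icc a b)) :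
    ∃ w, IsEdgeWeight w E F := by
  have hdeg := degreeSequence_of_sdiff_eq_omega hE hF hle hab h
  have hρE := comp_reflectIcc fun i hi => (hdeg i hi).1
  have hρF := comp_reflectIcc fun i hi => (hdeg i hi).2
  have hzero : ∀ i j, (F \ E).Adj i j → symmExcess E F (reflectIcc a b) i = 0 := by
    intro i j hij
    have hi : i ∈ Finset.Icc a b := by
      by_contra hi
      exact degreeSequence_eq_zero_iff.1 (by rw [h, omega, if_neg hi]) j hij
    rw [symmExcess_apply hρE hρF (add_reflectIcc hi), (hdeg i hi).1, (hdeg i hi).2]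
    ring
  exact ⟨_, isEdgeWeight_symmExcess (s := 0) hE hF hle hρE hρF fun i j hij => by
    rw [hzero i j hij, hzero j i hij.symm, add_zero, abs_zero]
    exact ⟨rfl, rfl⟩⟩

lemma omegaPair_Icc_left {a b c d i : Fin n} (hcd : c ≤ d) (hi : i ∈ Finset.Icc a b) :
    omegaPair (Finset.Icc a b) (Finset.Icc c d) i = d + 1 - c := by
  rw [omegaPair, if_pos hi, cast_card_Icc hcd]

lemma omegaPair_Icc_right {a b c d i : Fin n} (hab : a ≤ b) (hbc : b < c)
    (hi : i ∈ Finset.Icc c d) :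
    omegaPair (Finset.Icc a b) (Finset.Icc c d) i = b + 1 - a := by
  have hi' : i ∉ Finset.Icc a b := fun hi' =>
    ((Finset.mem_Icc.1 hi').2.trans_lt hbc).not_ge (Finset.mem_Icc.1 hi).1
  rw [omegaPair, if_neg hi', if_pos hi, cast_card_Icc hab]

lemma degreeSequence_ends_of_sdiff_eq_omegaPair {a b c d : Fin n} (hE : IsShifted E)
    (hF : IsShifted F) (hab : a ≤ b) (hbc : b < c) (hcd : c ≤ d)
    (h : degreeSequence (F \ E) = omegaPair (Finset.Icc a b) (Finset.Icc c d)) :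
    degreeSequence F a = d ∧ degreeSequence E d = a := by
  refine degreeSequence_ends hE hF (fun i hi => ?_) ?_ ?_
  · contrapose! hi
    rw [Finset.mem_Icc] at hi
    rw [h, omegaPair, if_neg, if_neg] <;>
    · rw [Finset.mem_Icc]
      omega
  · have hcd' : ((c : ℕ) : ℝ) ≤ d := Nat.cast_le.2 hcd
    rw [h, omegaPair_Icc_left hcd (Finset.left_mem_Icc.2 hab)]
    linarith
  · have hab' : ((a : ℕ) : ℝ) ≤ b := Nat.cast_le.2 hab
    rw [h, omegaPair_Icc_right hab hbc (Finset.right_mem_Icc.2 hcd)]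
    linarith

lemma degreeSequence_of_sdiff_eq_omegaPair {a b c d : Fin n} (hE : IsShifted E) (hF : IsShifted F)
    (hle : E ≤ F) (hab : a ≤ b) (hbc : b < c) (hcd : c ≤ d)
    (h : degreeSequence (F \ E) = omegaPair (Finset.Icc a b) (Finset.Icc c d)) :
    (∀ i ∈ Finset.Icc a b, degreeSequence E i = c - 1 ∧ degreeSequence F i = d) ∧
      ∀ j ∈ Finset.Icc c d, degreeSequence E j = a ∧ degreeSequence F j = b + 1 := by
  classical
  obtain ⟨hFa, hEd⟩ := degreeSequence_ends_of_sdiff_eq_omegaPair hE hF hab hbc hcd h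
  have hsdiff := fun i => congrFun (degreeSequence_sdiff hle) i
  simp only [h, Pi.sub_apply] at hsdiff
  have hI : ∀ i ∈ Finset.Icc a b, degreeSequence F i = degreeSequence E i + (d - (c - 1)) :=
    fun i hi => by linarith [hsdiff i, omegaPair_Icc_left hcd hi]
  have hJ : ∀ j ∈ Finset.Icc c d, degreeSequence F j = degreeSequence E j + (b + 1 - a) :=
    fun j hj => by linarith [hsdiff j, omegaPair_Icc_right hab hbc hj]
  have hFb : ((d : ℕ) : ℝ) ≤ degreeSequence F b := by
    have hFd : ((b : ℕ) : ℝ) < F.degree d := by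
      linarith [hJ d (Finset.right_mem_Icc.2 hcd), degreeSequence_apply F d]
    have hbd : F.Adj b d := (hF.adj_iff_lt_degree (hbc.trans_le hcd)).2 (Nat.cast_lt.1 hFd)
    exact Nat.cast_le.2 ((hF.adj_iff_le_degree (hbc.trans_le hcd)).1 hbd)
  have hEc : degreeSequence E c ≤ a := by
    have hEa : (E.degree a : ℝ) < (c : ℕ) := by
      linarith [hI a (Finset.left_mem_Icc.2 hab), degreeSequence_apply E a]
    have hac : ¬E.Adj a c :=
      (hE.adj_iff_le_degree (hab.trans_lt hbc)).not.2 (Nat.cast_lt.1 hEa).not_ge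
    exact Nat.cast_le.2 (not_lt.1 ((hE.adj_iff_lt_degree (hab.trans_lt hbc)).not.1 hac))
  refine ⟨forall_mem_Icc_eq_of_antitone hE.antitone_degreeSequence hF.antitone_degreeSequence hI
    hFa.le ?_, forall_mem_Icc_eq_of_antitone hE.antitone_degreeSequence
      hF.antitone_degreeSequence hJ ?_ hEd.ge⟩
  · linarith [hI b (Finset.right_mem_Icc.2 hab)]
  · linarith [hJ c (Finset.left_mem_Icc.2 hcd)]

/-- Two vertices of `[a, b]` are adjacent already in `E`, and two of `[c, d]` are not even adjacent
in `F`. -/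
lemma mem_Icc_or_of_sdiff_adj {a b c d i j : Fin n} (hE : IsShifted E) (hF : IsShifted F)
    (hbc : b < c) (h : degreeSequence (F \ E) = omegaPair (Finset.Icc a b) (Finset.Icc c d))
    (hI : ∀ i ∈ Finset.Icc a b, degreeSequence E i = c - 1)
    (hJ : ∀ j ∈ Finset.Icc c d, degreeSequence F j = b + 1) (hij : (F \ E).Adj i j) :
    i ∈ Finset.Icc a b ∧ j ∈ Finset.Icc c d ∨ i ∈ Finset.Icc c d ∧ j ∈ Finset.Icc a b := by
  classical
  have hmem : ∀ k l, (F \ E).Adj k l → k ∈ Finset.Icc a b ∨ k ∈ Finset.Icc c d := by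
    intro k l hkl
    by_contra! hk
    exact degreeSequence_eq_zero_iff.1 (by rw [h, omegaPair, if_neg hk.1, if_neg hk.2]) l hkl
  wlog hlt : i < j generalizing i j
  · have := this hij.symm (hij.ne.lt_or_gt.resolve_left hlt)
    tauto
  rcases hmem i j hij with hi | hi <;> rcases hmem j i hij.symm with hj | hj
  · refine absurd ((hE.adj_iff_le_degree hlt).2 ?_) hij.2
    have hEi : (E.degree i : ℝ) + 1 = (c : ℕ) := by linarith [hI i hi, degreeSequence_apply E i]
    have hEi' : E.degree i + 1 = c := by exact_mod_cast hEi
    have := (Finset.mem_Icc.1 hj).2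
    omega
  · exact Or.inl ⟨hi, hj⟩
  · exact Or.inr ⟨hi, hj⟩
  · have hFj : (F.degree j : ℝ) = (b : ℕ) + 1 := hJ j hj
    have hFj' : F.degree j = b + 1 := by exact_mod_cast hFj
    have := (hF.adj_iff_lt_degree hlt).1 hij.1
    have := (Finset.mem_Icc.1 hi).1
    omega

lemma exists_isEdgeWeight_of_sdiff_eq_omegaPair {a b c d : Fin n} (hE : IsShifted E)
    (hF : IsShifted F) (hle : E ≤ F) (hab : a ≤ b) (hbc : b < c) (hcd : c ≤ d)
    (h : degreeSequence (F \ E) = omegaPair (Finset.Icc a b) (Finset.Icc c d)) :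
    ∃ w, IsEdgeWeight w E F := by
  obtain ⟨hI, hJ⟩ := degreeSequence_of_sdiff_eq_omegaPair hE hF hle hab hbc hcd h
  have hdisj : ∀ i ∈ Finset.Icc c d, i ∉ Finset.Icc a b := fun i hi hi' =>
    ((Finset.mem_Icc.1 hi').2.trans_lt hbc).not_ge (Finset.mem_Icc.1 hi).1
  set ρ := reflectIcc a b * reflectIcc c d
  have hρ : ∀ f : Fin n → ℝ, f ∘ reflectIcc a b = f → f ∘ reflectIcc c d = f → f ∘ ρ = f :=
    fun f hfI hfJ => by rw [Equiv.Perm.coe_mul, ← Function.comp_assoc, hfI, hfJ]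
  have hρE := hρ _ (comp_reflectIcc fun i hi => (hI i hi).1)
    (comp_reflectIcc fun j hj => (hJ j hj).1)
  have hρF := hρ _ (comp_reflectIcc fun i hi => (hI i hi).2)
    (comp_reflectIcc fun j hj => (hJ j hj).2)
  have hwI : ∀ i ∈ Finset.Icc a b, symmExcess E F ρ i = 2 * (c + d - 1 - a - b) := by
    intro i hi
    have hρi : ρ i = reflectIcc a b i :=
      congrArg (reflectIcc a b) (reflectIcc_of_notMem fun hi' => hdisj i hi' hi)
    rw [symmExcess_apply hρE hρF (hρi ▸ add_reflectIcc hi), (hI i hi).1, (hI i hi).2]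
    ring
  have hwJ : ∀ j ∈ Finset.Icc c d, symmExcess E F ρ j = -(2 * (c + d - 1 - a - b)) := by
    intro j hj
    have hρj : ρ j = reflectIcc c d j := reflectIcc_of_notMem (hdisj _ (reflectIcc_mem hj))
    rw [symmExcess_apply hρE hρF (hρj ▸ add_reflectIcc hj), (hJ j hj).1, (hJ j hj).2]
    ring
  refine ⟨_, isEdgeWeight_symmExcess (s := |2 * ((c : ℝ) + d - 1 - a - b)|) hE hF hle hρE hρF
    fun i j hij => ?_⟩
  rcases mem_Icc_or_of_sdiff_adj hE hF hbc h (fun i hi => (hI i hi).1) (fun j hj => (hJ j hj).2)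
    hij with ⟨hi, hj⟩ | ⟨hi, hj⟩
  · rw [hwI i hi, hwJ j hj]
    exact ⟨add_neg_cancel _, rfl⟩
  · rw [hwJ i hi, hwI j hj]
    exact ⟨neg_add_cancel _, abs_neg _⟩

end EdgeVectorWeights

section Adjacency

variable {n : ℕ} {E F : SimpleGraph (Fin n)}

lemma IsEdgeVector.exists_isEdgeWeight (h : IsEdgeVector (degreeSequence (F \ E)))
    (hE : IsShifted E) (hF : IsShifted F) (hle : E ≤ F) : ∃ w, IsEdgeWeight w E F := by
  obtain ⟨_, ⟨a, b, hab, rfl⟩, hcard, h⟩ | ⟨_, _, ⟨a, b, hab, rfl⟩, ⟨c, d, hcd, rfl⟩, hlt, h⟩ := h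
  · refine exists_isEdgeWeight_of_sdiff_eq_omega hE hF hle (hab.lt_of_ne ?_) h
    rintro rfl
    simp at hcard
  · exact exists_isEdgeWeight_of_sdiff_eq_omegaPair hE hF hle hab
      (hlt b (Finset.right_mem_Icc.2 hab) c (Finset.left_mem_Icc.2 hcd)) hcd h

lemma AdjacentExtremePoints.symm {P : Set (Fin n → ℝ)} {x y : Fin n → ℝ}
    (h : AdjacentExtremePoints P x y) : AdjacentExtremePoints P y x :=
  ⟨h.2.1, h.1, h.2.2.1.symm, segment_symm ℝ x y ▸ h.2.2.2⟩

lemma adjacentExtremePoints_comm {P : Set (Fin n → ℝ)} {x y : Fin n → ℝ} :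
    AdjacentExtremePoints P x y ↔ AdjacentExtremePoints P y x :=
  ⟨.symm, .symm⟩

lemma AdjacentExtremePoints.le_or_le (hE : IsShifted E) (hF : IsShifted F)
    (h : AdjacentExtremePoints (degreePartitionPolytope n) (degreeSequence E) (degreeSequence F)) :
    degreeSequence E ≤ degreeSequence F ∨ degreeSequence F ≤ degreeSequence E := by
  obtain ⟨w, -, hw | hw⟩ := exists_isEdgeWeight hE hF h
  exacts [Or.inl (degreeSequence_mono hw.le), Or.inr (degreeSequence_mono hw.le)]

lemma adjacentExtremePoints_iff_of_le (hE : IsShifted E) (hF : IsShifted F)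
    (hle : degreeSequence E ≤ degreeSequence F) :
    AdjacentExtremePoints (degreePartitionPolytope n) (degreeSequence E) (degreeSequence F) ↔
      IsEdgeVector (degreeSequence F - degreeSequence E) := by
  have hEF := hE.le_of_degreeSequence_le hF hle
  rw [← degreeSequence_sdiff hEF]
  constructor
  · intro h
    have hne : E ≠ F := fun h' => h.2.2.1 (congrArg degreeSequence h')
    obtain ⟨w, hw, hedge | hedge⟩ := exists_isEdgeWeight hE hF h
    · exact hedge.isEdgeVector hw hne
    · exact absurd (hEF.antisymm hedge.le) hne
  · intro h
    have hne : degreeSequence E ≠ degreeSequence F := fun h' =>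
      h.ne_zero (by rw [degreeSequence_sdiff hEF, h', sub_self])
    obtain ⟨w, hw⟩ := h.exists_isEdgeWeight hE hF hEF
    exact ⟨hE.mem_extremePoints, hF.mem_extremePoints, hne,
      hw.isExposed hE hF fun h' => hne (congrArg degreeSequence h')⟩

lemma adjacentExtremePoints_iff (hE : IsShifted E) (hF : IsShifted F) :
    AdjacentExtremePoints (degreePartitionPolytope n) (degreeSequence E) (degreeSequence F) ↔
      (degreeSequence E ≤ degreeSequence F ∨ degreeSequence F ≤ degreeSequence E) ∧
        IsEdgeVector |degreeSequence E - degreeSequence F| := by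
  rw [← and_iff_right_of_imp fun h => AdjacentExtremePoints.le_or_le hE hF h]
  refine and_congr_right ?_
  rintro (hle | hle)
  · rw [adjacentExtremePoints_iff_of_le hE hF hle, abs_sub_comm, abs_of_nonneg (sub_nonneg.2 hle)]
  · rw [adjacentExtremePoints_comm, adjacentExtremePoints_iff_of_le hF hE hle,
      abs_of_nonneg (sub_nonneg.2 hle)]

end Adjacency

end DegreePartitions

theorem mainTheorem4 (n : ℕ) (hn : 3 ≤ n) (d e : Fin n → ℝ)
    (hd : d ∈ DegreePartitions.thresholdPartitions n)
    (he : e ∈ DegreePartitions.thresholdPartitions n) :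
    DegreePartitions.AdjacentExtremePoints (DegreePartitions.degreePartitionPolytope n) d e ↔
      (d ≤ e ∨ e ≤ d) ∧
        ((∃ I : Finset (Fin n), DegreePartitions.IsInterval I ∧ 2 ≤ I.card ∧
            |d - e| = DegreePartitions.omega I) ∨
          (∃ I J : Finset (Fin n), DegreePartitions.IsInterval I ∧ DegreePartitions.IsInterval J ∧
            (∀ i ∈ I, ∀ j ∈ J, i < j) ∧ |d - e| = DegreePartitions.omegaPair I J)) := by
  obtain ⟨E, hE, rfl⟩ := DegreePartitions.exists_isShifted_of_mem_thresholdPartitions hd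
  obtain ⟨F, hF, rfl⟩ := DegreePartitions.exists_isShifted_of_mem_thresholdPartitions he
  exact DegreePartitions.adjacentExtremePoints_iff hE hF
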